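/- Let $n\ge 1$ be an integer and $s\in(0,1)$. Let $$C(n,s):=\Big(\int_{\mathbb R^n}\frac{1-\cos\omega_1}{|\omega|^{n+2s}}\,d\omega\Big)^{-1},$$ let $\omega_n$ be the $(n-1)$-dimensional surface measure of the unit sphere $\partial B_1\subset\mathbb R^n$ (so $\omega_1=2$), and let $B(\alpha,\beta)=\Gamma(\alpha)\Gamma(\beta)/\Gamma(\alpha+\beta)$ be the Beta function. For $u:\mathbb R^n\to\mathbb R$ put $$(-\Delta)^s u(x):=\frac{C(n,s)}{2}\int_{\mathbb R^n}\frac{2u(x)-u(x+y)-u(x-y)}{|y|^{n+2s}}\,dy$$ whenever the integral converges absolutely. Let $\mathcal U(x):=(1-|x|^2)_+^s$ for $x\in\mathbb R^n$. Then $C(n,s)$ is a well-defined positive finite number, and for every $x$ in the open unit ball $B_1$ the integral defining $(-\Delta)^s\,\mathcal U(x)$ converges absolutely and $$(-\Delta)^s\,\mathcal U(x)=C(n,s)\,\frac{\omega_n}{2}\,B(s,1-s).$$ Equivalently, in the principal value form of the operator, $$\mathrm{P.V.}\int_{\mathbb R^n}\frac{\mathcal U(x)-\mathcal U(y)}{|x-y|^{n+2s}}\,dy:=\lim_{\varepsilon\to0^+}\int_{\mathbb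 R^n\setminus B_\varepsilon(x)}\frac{\mathcal U(x)-\mathcal U(y)}{|x-y|^{n+2s}}\,dy=\frac{\omega_n}{2}\,B(s,1-s),$$ where the integrals over $\mathbb R^n\setminus B_\varepsilon(x)$ converge absolutely and the limit exists. -/

import Mathlib

open MeasureTheory Filter Topology

namespace FracLap

/-- The normalizing constant `C(n,s) = (∫_{ℝⁿ} (1 - cos ω₁) / |ω|^{n+2s} dω)⁻¹`;
the first coordinate of `ω` has index `0`. -/
noncomputable def fracConst (n : ℕ) [NeZero n] (s : ℝ) : ℝ :=
  (∫ ω : EuclideanSpace ℝ (Fin n), (1 - Real.cos (ω 0)) / ‖ω‖ ^ ((n : ℝ) + 2 * s))⁻¹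

/-- The second difference quotient `(2u(x) - u(x+y) - u(x-y)) / |y|^{n+2s}`. -/
noncomputable def secondDiffQuot {n : ℕ} (s : ℝ) (u : EuclideanSpace ℝ (Fin n) → ℝ)
    (x y : EuclideanSpace ℝ (Fin n)) : ℝ :=
  (2 * u x - u (x + y) - u (x - y)) / ‖y‖ ^ ((n : ℝ) + 2 * s)

/-- `(-Δ)^s u(x) = (C(n,s)/2) ∫_{ℝⁿ} (2u(x) - u(x+y) - u(x-y)) / |y|^{n+2s} dy`. It has its
intended meaning when the integrand is integrable. -/
noncomputable def fracLaplacian {n : ℕ} [NeZero n] (s : ℝ) (u : EuclideanSpace ℝ (Fin n) → ℝ)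
    (x : EuclideanSpace ℝ (Fin n)) : ℝ :=
  fracConst n s / 2 * ∫ y, secondDiffQuot s u x y

/-- The principal value integral `P.V. ∫_{ℝⁿ} f(y) dy` with singularity at `x` exists and equals
`a`: `f` is integrable off every ball about `x`, and the integrals over the complements of the
balls of radius `ε` converge to `a` as `ε → 0⁺`. -/
def HasPVIntegral {n : ℕ} (f : EuclideanSpace ℝ (Fin n) → ℝ) (x : EuclideanSpace ℝ (Fin n))
    (a : ℝ) : Prop :=
  (∀ ε : ℝ, 0 < ε → IntegrableOn f (Metric.ball x ε)ᶜ) ∧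
    Tendsto (fun ε : ℝ => ∫ y in (Metric.ball x ε)ᶜ, f y) (𝓝[>] 0) (𝓝 a)

/-- `𝒰(x) = (1 - |x|²)₊^s`. -/
noncomputable def ballPower (n : ℕ) (s : ℝ) (x : EuclideanSpace ℝ (Fin n)) : ℝ :=
  (max (1 - ‖x‖ ^ 2) 0) ^ s

/-- `ω_n`, the surface measure of the unit sphere of `ℝⁿ`. -/
noncomputable def sphereArea (n : ℕ) : ℝ :=
  (volume : Measure (EuclideanSpace ℝ (Fin n))).toSphere.real Set.univ

end FracLap

/-!
On the line `r ↦ x + rθ` the function `𝒰` is `v(r) = (c - 2br - r²)₊^s` with `c = 1 - |x|²` and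
`b = ⟪x, θ⟫`. In polar coordinates it is therefore enough to show that, for every `b`,
`∫₀^∞ (2v(0) - v(r) - v(-r)) r^(-1-2s) dr = B(s, 1-s)`. Substitute `(c - 2br - r²) / r² = 1/t - 1`,
that is `r = ρ_b(t) = √(b²t² + ct) - bt`, on the ray of direction `θ`, and `r = ρ_{-b}(t)` on the
opposite ray. Since `ρ_b ρ_{-b} = ct`, the logarithmic derivatives of the two substitutions add up
to `1/t`, and the dependence on `b` disappears: what remains is `∫ (1-t)^s t^(-s-1) dt` over
`(a, 1)`, whose finite part as `a → 0` is `B(s, 1-s)` by an integration by parts. The two rays are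
cut off at different radii `ρ_b(a)` and `ρ_{-b}(a)`, but these differ by only `2|b|a`, which costs
`O(a^(1-s))`.
-/

namespace FracLap

open Asymptotics Metric Set
open scoped Real

section SecondDifference

variable {E F : Type*} [NormedAddCommGroup E] [NormedSpace ℝ E] [NormedAddCommGroup F]
  [NormedSpace ℝ F]

theorem isBigO_second_difference {u : E → F} {x : E} (hu : ContDiffAt ℝ 2 u x) :
    (fun y => (2 : ℝ) • u x - u (x + y) - u (x - y)) =O[𝓝 0] fun y => ‖y‖ ^ 2 := by
  obtain ⟨K, t, ht, hK⟩ := (hu.fderiv_right (m := 1) (by norm_num)).exists_lipschitzOnWith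
  have hdiff : ∀ᶠ z in 𝓝 x, DifferentiableAt ℝ u z :=
    (hu.eventually (by simp)).mono fun z hz => hz.differentiableAt (by simp)
  obtain ⟨ε, hε, hball⟩ := Metric.mem_nhds_iff.1 (inter_mem ht hdiff)
  refine IsBigO.of_bound (2 * K) ?_
  filter_upwards [ball_mem_nhds (0 : E) hε] with y hy
  have hmem : ∀ z ∈ closedBall (0 : E) ‖y‖, x + z ∈ ball x ε ∧ x - z ∈ ball x ε := fun z hz => by
    have : ‖z‖ < ε := (mem_closedBall_zero_iff.1 hz).trans_lt (mem_ball_zero_iff.1 hy)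
    simpa [dist_eq_norm] using this
  have hderiv : ∀ z ∈ closedBall (0 : E) ‖y‖, HasFDerivWithinAt (fun z => u (x + z) + u (x - z))
      (fderiv ℝ u (x + z) - fderiv ℝ u (x - z)) (closedBall 0 ‖y‖) z := fun z hz => by
    have h₁ := (hball (hmem z hz).1).2.hasFDerivAt.comp z ((hasFDerivAt_id z).const_add x)
    have h₂ := (hball (hmem z hz).2).2.hasFDerivAt.comp z ((hasFDerivAt_id z).const_sub x)
    refine ((h₁.add h₂).congr_fderiv ?_).hasFDerivWithinAt
    simp [sub_eq_add_neg]
  have hbound : ∀ z ∈ closedBall (0 : E) ‖y‖,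
      ‖fderiv ℝ u (x + z) - fderiv ℝ u (x - z)‖ ≤ 2 * K * ‖y‖ := fun z hz => by
    calc ‖fderiv ℝ u (x + z) - fderiv ℝ u (x - z)‖
        ≤ K * ‖(x + z) - (x - z)‖ :=
          hK.norm_sub_le (hball (hmem z hz).1).1 (hball (hmem z hz).2).1
      _ = 2 * K * ‖z‖ := by
          rw [add_sub_sub_cancel, ← two_smul ℝ z, norm_smul, Real.norm_ofNat]
          ring
      _ ≤ 2 * K * ‖y‖ := by gcongr; exact mem_closedBall_zero_iff.1 hz
  have hmvt := (convex_closedBall (0 : E) ‖y‖).norm_image_sub_le_of_norm_hasFDerivWithin_le hderiv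
    hbound (mem_closedBall_self (norm_nonneg y)) (mem_closedBall_zero_iff.2 le_rfl)
  calc ‖(2 : ℝ) • u x - u (x + y) - u (x - y)‖
      = ‖u (x + y) + u (x - y) - (u (x + 0) + u (x - 0))‖ := by
        rw [← norm_neg, add_zero, sub_zero, two_smul]
        congr 1
        abel
    _ ≤ 2 * K * ‖y‖ * ‖y - 0‖ := hmvt
    _ = 2 * K * ‖‖y‖ ^ 2‖ := by
        rw [sub_zero, norm_pow, norm_norm]
        ring

end SecondDifference

section PolarCoordinates

theorem integrableOn_Ioi_piecewise_sq_mul_rpow {s ρ : ℝ} (C M : ℝ) (hs₀ : 0 < s) (hs₁ : s < 1)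
    (hρ : 0 < ρ) :
    IntegrableOn (fun r : ℝ => (if r < ρ then C * r ^ 2 else M) * r ^ (-1 - 2 * s)) (Ioi 0) := by
  rw [← Ioo_union_Ici_eq_Ioi hρ]
  refine IntegrableOn.union ?_ ?_
  · have h : IntegrableOn (fun r : ℝ => r ^ (1 - 2 * s)) (Ioo 0 ρ) :=
      (intervalIntegral.integrableOn_Ioo_rpow_iff hρ).2 (by linarith)
    refine (integrableOn_congr_fun (fun r hr => ?_) measurableSet_Ioo).1 (h.const_mul C)
    simp only [if_pos hr.2]
    rw [show 1 - 2 * s = 2 + (-1 - 2 * s) by ring, Real.rpow_add hr.1, Real.rpow_two, mul_assoc]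
  · rw [integrableOn_Ici_iff_integrableOn_Ioi]
    refine (integrableOn_congr_fun (fun r hr => ?_) measurableSet_Ioi).1
      ((integrableOn_Ioi_rpow_of_lt (a := -1 - 2 * s) (by linarith) hρ).const_mul M)
    simp only [if_neg (mem_Ioi.1 hr).not_gt]

theorem pow_pred_mul_div_rpow {d : ℕ} (hd : d ≠ 0) {r : ℝ} (hr : 0 < r) (a s : ℝ) :
    r ^ (d - 1) * (a / r ^ ((d : ℝ) + 2 * s)) = a * r ^ (-1 - 2 * s) := by
  rw [← Real.rpow_natCast, Nat.cast_pred (Nat.pos_of_ne_zero hd),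
    show -1 - 2 * s = ((d : ℝ) - 1) - ((d : ℝ) + 2 * s) by ring, Real.rpow_sub hr (_ - 1)]
  ring

variable {E F : Type*} [NormedAddCommGroup E] [NormedSpace ℝ E] [FiniteDimensional ℝ E]
  [MeasurableSpace E] [BorelSpace E] {μ : Measure E} [μ.IsAddHaarMeasure]
  [NormedAddCommGroup F]

theorem integrable_sphere_prod_Ioi {f : E → F} (hf : Integrable f μ) :
    Integrable (fun p : sphere (0 : E) 1 × Ioi (0 : ℝ) => f ((p.2 : ℝ) • (p.1 : E)))
      (μ.toSphere.prod (.volumeIoiPow (Module.finrank ℝ E - 1))) := by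
  rw [← μ.measurePreserving_homeomorphUnitSphereProd.integrable_comp_emb
    (homeomorphUnitSphereProd E).measurableEmbedding]
  have hcomp : (fun p : sphere (0 : E) 1 × Ioi (0 : ℝ) => f ((p.2 : ℝ) • (p.1 : E))) ∘
      homeomorphUnitSphereProd E = f ∘ Subtype.val := by
    ext y
    simp [smul_smul, norm_ne_zero_iff.2 y.2]
  rw [hcomp, ← integrableOn_iff_comap_subtypeVal (by measurability)]
  exact hf.integrableOn

variable [NormedSpace ℝ F]

theorem integral_volumeIoiPow (k : ℕ) (g : ℝ → F) :
    ∫ r, g r ∂Measure.volumeIoiPow k = ∫ r in Ioi (0 : ℝ), r ^ k • g r := by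
  simp only [Measure.volumeIoiPow, ENNReal.ofReal]
  rw [integral_withDensity_eq_integral_smul (measurable_subtype_coe.pow_const _).real_toNNReal,
    integral_subtype_comap measurableSet_Ioi fun r => Real.toNNReal (r ^ k) • g r]
  refine setIntegral_congr_fun measurableSet_Ioi fun r hr => ?_
  rw [NNReal.smul_def, Real.coe_toNNReal _ (pow_nonneg (mem_Ioi.1 hr).le _)]

variable [Nontrivial E]

theorem integral_eq_integral_sphere_integral_Ioi {f : E → F} (hf : Integrable f μ) :
    ∫ y, f y ∂μ = ∫ θ : sphere (0 : E) 1, (∫ r in Ioi (0 : ℝ),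
      r ^ (Module.finrank ℝ E - 1) • f (r • (θ : E))) ∂μ.toSphere := by
  have hpolar := μ.measurePreserving_homeomorphUnitSphereProd.integral_comp
    (homeomorphUnitSphereProd E).measurableEmbedding
    fun p : sphere (0 : E) 1 × Ioi (0 : ℝ) => f ((p.2 : ℝ) • (p.1 : E))
  calc ∫ y, f y ∂μ = ∫ y : ({0}ᶜ : Set E), f y ∂(μ.comap (↑)) := by
        rw [integral_subtype_comap (measurableSet_singleton _).compl f, restrict_compl_singleton]
    _ = ∫ p : sphere (0 : E) 1 × Ioi (0 : ℝ), f ((p.2 : ℝ) • (p.1 : E))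
          ∂μ.toSphere.prod (.volumeIoiPow (Module.finrank ℝ E - 1)) := by
        rw [← hpolar]
        refine integral_congr_ae (.of_forall fun y => ?_)
        simp [smul_smul, norm_ne_zero_iff.2 y.2]
    _ = _ := by
        rw [integral_prod _ (integrable_sphere_prod_Ioi hf)]
        exact integral_congr_ae (.of_forall fun θ =>
          integral_volumeIoiPow _ fun r => f (r • (θ : E)))

theorem integrable_div_norm_rpow {s M : ℝ} (hs₀ : 0 < s) (hs₁ : s < 1) {f : E → ℝ}
    (hf : AEStronglyMeasurable f μ) (hf₀ : f =O[𝓝 0] fun y => ‖y‖ ^ 2) (hM : ∀ y, |f y| ≤ M) :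
    Integrable (fun y => f y / ‖y‖ ^ ((Module.finrank ℝ E : ℝ) + 2 * s)) μ := by
  obtain ⟨C, hC⟩ := hf₀.bound
  obtain ⟨ρ, hρ, hball⟩ := Metric.eventually_nhds_iff_ball.1 hC
  have hdom : Integrable (fun y : E => (fun r : ℝ => (if r < ρ then C * r ^ 2 else M) /
      r ^ ((Module.finrank ℝ E : ℝ) + 2 * s)) ‖y‖) μ := by
    refine (integrable_fun_norm_addHaar μ (f := fun r : ℝ => (if r < ρ then C * r ^ 2 else M) /
      r ^ ((Module.finrank ℝ E : ℝ) + 2 * s))).2 ?_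
    refine (integrableOn_congr_fun (fun r hr => ?_) measurableSet_Ioi).1
      (integrableOn_Ioi_piecewise_sq_mul_rpow C M hs₀ hs₁ hρ)
    rw [smul_eq_mul, pow_pred_mul_div_rpow Module.finrank_pos.ne' hr]
  refine hdom.mono' (hf.div₀ (measurable_norm.pow_const _).aestronglyMeasurable)
    (.of_forall fun y => ?_)
  have hpow : 0 ≤ ‖y‖ ^ ((Module.finrank ℝ E : ℝ) + 2 * s) := Real.rpow_nonneg (norm_nonneg y) _
  rw [norm_div, Real.norm_of_nonneg hpow]
  refine div_le_div_of_nonneg_right ?_ hpow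
  split_ifs with hy
  · simpa using hball y (mem_ball_zero_iff.2 hy)
  · exact hM y

end PolarCoordinates

section SecondDiffQuot

variable {n : ℕ} {s M : ℝ} {u : EuclideanSpace ℝ (Fin n) → ℝ} {x : EuclideanSpace ℝ (Fin n)}

theorem integrable_secondDiffQuot [NeZero n] (hs₀ : 0 < s) (hs₁ : s < 1)
    (hu : AEStronglyMeasurable u) (hM : ∀ y, |u y| ≤ M) (hux : ContDiffAt ℝ 2 u x) :
    Integrable (secondDiffQuot s u x) := by
  have hmeas : AEStronglyMeasurable fun y => 2 * u x - u (x + y) - u (x - y) :=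
    (aestronglyMeasurable_const.sub
      (hu.comp_measurePreserving (measurePreserving_add_left volume x))).sub
      (hu.comp_measurePreserving (Measure.measurePreserving_sub_left volume x))
  have hbound : ∀ y, |2 * u x - u (x + y) - u (x - y)| ≤ 2 * M + M + M := fun y => by
    refine (abs_sub _ _).trans (add_le_add ((abs_sub _ _).trans (add_le_add ?_ (hM _))) (hM _))
    rw [abs_mul, abs_two]
    exact mul_le_mul_of_nonneg_left (hM x) zero_le_two
  have hint := integrable_div_norm_rpow hs₀ hs₁ hmeas (isBigO_second_difference hux) hbound
  rwa [finrank_euclideanSpace_fin] at hint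

theorem integral_secondDiffQuot [NeZero n] (h : Integrable (secondDiffQuot s u x)) :
    ∫ y, secondDiffQuot s u x y = ∫ θ : sphere (0 : EuclideanSpace ℝ (Fin n)) 1,
      (∫ r in Ioi (0 : ℝ), (2 * u x - u (x + r • (θ : EuclideanSpace ℝ (Fin n))) -
        u (x - r • (θ : EuclideanSpace ℝ (Fin n)))) * r ^ (-1 - 2 * s)) ∂volume.toSphere := by
  rw [integral_eq_integral_sphere_integral_Ioi h]
  refine integral_congr_ae (.of_forall fun θ => setIntegral_congr_fun measurableSet_Ioi
    fun r hr => ?_)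
  have hnorm : ‖r • (θ : EuclideanSpace ℝ (Fin n))‖ = r := by
    simp [norm_smul, abs_of_pos (mem_Ioi.1 hr)]
  simp only [secondDiffQuot, hnorm, finrank_euclideanSpace_fin, smul_eq_mul]
  exact pow_pred_mul_div_rpow (NeZero.ne n) hr _ _

theorem integrableOn_compl_ball_sub_div_norm_rpow (hs₀ : 0 < s) (hu : AEStronglyMeasurable u)
    (hM : ∀ y, |u y| ≤ M) (x : EuclideanSpace ℝ (Fin n)) {ε : ℝ} (hε : 0 < ε) :
    IntegrableOn (fun y => (u x - u y) / ‖x - y‖ ^ ((n : ℝ) + 2 * s)) (ball x ε)ᶜ := by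
  have hdom := ((integrable_one_add_norm (μ := (volume : Measure (EuclideanSpace ℝ (Fin n))))
    (r := (n : ℝ) + 2 * s) (by simpa using hs₀)).comp_sub_left x).const_mul
    ((M + M) * (1 + 1 / ε) ^ ((n : ℝ) + 2 * s))
  refine hdom.integrableOn.mono' ((aestronglyMeasurable_const.sub hu).div₀
    (((measurable_const.sub measurable_id).norm.pow_const _).aestronglyMeasurable)).restrict ?_
  filter_upwards [ae_restrict_mem measurableSet_ball.compl] with y hy
  have hxy : ε ≤ ‖x - y‖ := by simpa [dist_eq_norm, norm_sub_rev] using hy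
  have hpos : 0 < ‖x - y‖ := hε.trans_le hxy
  have hbase : ‖x - y‖⁻¹ ≤ (1 + 1 / ε) / (1 + ‖x - y‖) := by
    have : 1 ≤ 1 / ε * ‖x - y‖ := by rwa [one_div_mul_eq_div, one_le_div hε]
    rw [inv_eq_one_div, div_le_div_iff₀ hpos (by positivity)]
    linarith
  calc ‖(u x - u y) / ‖x - y‖ ^ ((n : ℝ) + 2 * s)‖
      = |u x - u y| * ‖x - y‖⁻¹ ^ ((n : ℝ) + 2 * s) := by
        rw [norm_div, Real.norm_of_nonneg (Real.rpow_nonneg hpos.le _), Real.inv_rpow hpos.le,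
          div_eq_mul_inv, Real.norm_eq_abs]
    _ ≤ (M + M) * ((1 + 1 / ε) / (1 + ‖x - y‖)) ^ ((n : ℝ) + 2 * s) := by
        have hdiff : |u x - u y| ≤ M + M := (abs_sub _ _).trans (add_le_add (hM x) (hM y))
        gcongr
        exact (abs_nonneg _).trans hdiff
    _ = (M + M) * (1 + 1 / ε) ^ ((n : ℝ) + 2 * s) * (1 + ‖x - y‖) ^ (-((n : ℝ) + 2 * s)) := by
        rw [Real.div_rpow (by positivity) (by positivity), Real.rpow_neg (by positivity),
          div_eq_mul_inv, mul_assoc]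

theorem setIntegral_compl_ball_secondDiffQuot {ε : ℝ}
    (h : IntegrableOn (fun y => (u x - u y) / ‖x - y‖ ^ ((n : ℝ) + 2 * s)) (ball x ε)ᶜ) :
    ∫ z in (ball 0 ε)ᶜ, secondDiffQuot s u x z =
      2 * ∫ y in (ball x ε)ᶜ, (u x - u y) / ‖x - y‖ ^ ((n : ℝ) + 2 * s) := by
  set f := fun y => (u x - u y) / ‖x - y‖ ^ ((n : ℝ) + 2 * s)
  have hadd := measurePreserving_add_left (volume : Measure (EuclideanSpace ℝ (Fin n))) x
  have haddEmb := (MeasurableEquiv.addLeft x).measurableEmbedding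
  have hsub := Measure.measurePreserving_sub_left (volume : Measure (EuclideanSpace ℝ (Fin n))) x
  have hsubEmb := (MeasurableEquiv.subLeft x).measurableEmbedding
  have hballAdd : (x + ·) ⁻¹' (ball x ε)ᶜ = (ball 0 ε)ᶜ := by ext z; simp [dist_eq_norm]
  have hballSub : (x - ·) ⁻¹' (ball x ε)ᶜ = (ball 0 ε)ᶜ := by ext z; simp [dist_eq_norm]
  have hsplit : ∀ z, secondDiffQuot s u x z = f (x + z) + f (x - z) := fun z => by
    simp only [secondDiffQuot, f]
    rw [sub_add_cancel_left, norm_neg, sub_sub_cancel]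
    ring
  have hintAdd : IntegrableOn (fun z => f (x + z)) (ball 0 ε)ᶜ := by
    rw [← hballAdd]
    exact (hadd.integrableOn_comp_preimage haddEmb).2 h
  have hintSub : IntegrableOn (fun z => f (x - z)) (ball 0 ε)ᶜ := by
    rw [← hballSub]
    exact (hsub.integrableOn_comp_preimage hsubEmb).2 h
  have hvalAdd : ∫ z in (ball 0 ε)ᶜ, f (x + z) = ∫ y in (ball x ε)ᶜ, f y := by
    rw [← hballAdd]
    exact hadd.setIntegral_preimage_emb haddEmb f _
  have hvalSub : ∫ z in (ball 0 ε)ᶜ, f (x - z) = ∫ y in (ball x ε)ᶜ, f y := by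
    rw [← hballSub]
    exact hsub.setIntegral_preimage_emb hsubEmb f _
  simp only [hsplit]
  rw [integral_add hintAdd hintSub, hvalAdd, hvalSub, two_mul]

theorem aecover_compl_ball_zero {E : Type*} [NormedAddCommGroup E] [MeasurableSpace E]
    [OpensMeasurableSpace E] {μ : Measure E} [NullSingletonClass μ] :
    AECover μ (𝓝[>] 0) fun ε : ℝ => (ball 0 ε)ᶜ where
  ae_eventually_mem := by
    filter_upwards [compl_mem_ae_iff.2 (measure_singleton 0)] with z hz
    filter_upwards [Ioo_mem_nhdsGT (norm_pos_iff.2 hz)] with ε hε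
    simpa using hε.2.le
  measurableSet _ := measurableSet_ball.compl

theorem hasPVIntegral_sub_div_norm_rpow [NeZero n] (hs₀ : 0 < s) (hu : AEStronglyMeasurable u)
    (hM : ∀ y, |u y| ≤ M) (h : Integrable (secondDiffQuot s u x)) :
    HasPVIntegral (fun y => (u x - u y) / ‖x - y‖ ^ ((n : ℝ) + 2 * s)) x
      ((∫ y, secondDiffQuot s u x y) / 2) := by
  have hint := fun ε hε => integrableOn_compl_ball_sub_div_norm_rpow hs₀ hu hM x (ε := ε) hε
  refine ⟨hint, ((aecover_compl_ball_zero.integral_tendsto_of_countably_generated h).div_const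
    2).congr' ?_⟩
  filter_upwards [self_mem_nhdsWithin] with ε hε
  rw [setIntegral_compl_ball_secondDiffQuot (hint ε hε), mul_div_cancel_left₀ _ two_ne_zero]

end SecondDiffQuot

section FracConst

variable {n : ℕ} [NeZero n] {s : ℝ}

theorem integrable_one_sub_cos_div_norm_rpow (hs₀ : 0 < s) (hs₁ : s < 1) :
    Integrable fun ω : EuclideanSpace ℝ (Fin n) =>
      (1 - Real.cos (ω 0)) / ‖ω‖ ^ ((n : ℝ) + 2 * s) := by
  have hcont : Continuous fun ω : EuclideanSpace ℝ (Fin n) => 1 - Real.cos (ω 0) := by fun_prop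
  have habs : ∀ t : ℝ, |1 - Real.cos t| = 1 - Real.cos t := fun t =>
    abs_of_nonneg (sub_nonneg.2 (Real.cos_le_one t))
  have hquad : (fun ω : EuclideanSpace ℝ (Fin n) => 1 - Real.cos (ω 0)) =O[𝓝 0]
      fun ω => ‖ω‖ ^ 2 := by
    refine .of_bound' (.of_forall fun ω => ?_)
    have hcoord : (ω 0) ^ 2 ≤ ‖ω‖ ^ 2 := sq_le_sq.2 (by simpa using PiLp.norm_apply_le ω 0)
    rw [Real.norm_eq_abs, habs, Real.norm_of_nonneg (sq_nonneg _)]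
    linarith [Real.one_sub_sq_div_two_le_cos (x := ω 0), sq_nonneg (ω 0)]
  simpa only [finrank_euclideanSpace_fin] using
    integrable_div_norm_rpow hs₀ hs₁ hcont.aestronglyMeasurable hquad (M := 2)
      fun ω => by rw [habs]; linarith [Real.neg_one_le_cos (ω 0)]

theorem fracConst_pos (hs₀ : 0 < s) (hs₁ : s < 1) : 0 < fracConst n s := by
  have hnum : ∀ ω : EuclideanSpace ℝ (Fin n), 0 ≤ 1 - Real.cos (ω 0) := fun ω =>
    sub_nonneg.2 (Real.cos_le_one _)
  rw [fracConst, inv_pos, integral_pos_iff_support_of_nonneg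
    (fun ω => div_nonneg (hnum ω) (Real.rpow_nonneg (norm_nonneg _) _))
    (integrable_one_sub_cos_div_norm_rpow hs₀ hs₁)]
  have hopen : IsOpen {ω : EuclideanSpace ℝ (Fin n) | 0 < 1 - Real.cos (ω 0)} :=
    isOpen_lt continuous_const (by fun_prop)
  have hne : {ω : EuclideanSpace ℝ (Fin n) | 0 < 1 - Real.cos (ω 0)}.Nonempty :=
    ⟨EuclideanSpace.single 0 π, by simp⟩
  refine (hopen.measure_pos volume hne).trans_le (measure_mono fun ω hω => ?_)
  have hω₀ : ω ≠ 0 := by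
    rintro rfl
    simp at hω
  exact (div_pos hω (Real.rpow_pos_of_pos (norm_pos_iff.2 hω₀) _)).ne'

end FracConst

section BetaIntegral

variable {p q : ℝ}

theorem ofReal_rpow_mul_one_sub_rpow (α β : ℝ) {x : ℝ} (hx : x ∈ Icc (0 : ℝ) 1) :
    ((x ^ (α - 1) * (1 - x) ^ (β - 1) : ℝ) : ℂ) =
      (x : ℂ) ^ ((α : ℂ) - 1) * (1 - (x : ℂ)) ^ ((β : ℂ) - 1) := by
  rw [Complex.ofReal_mul, Complex.ofReal_cpow hx.1, Complex.ofReal_cpow (sub_nonneg.2 hx.2)]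
  push_cast
  rfl

theorem intervalIntegrable_rpow_mul_one_sub_rpow {α β : ℝ} (hα : 0 < α) (hβ : 0 < β) :
    IntervalIntegrable (fun x : ℝ => x ^ (α - 1) * (1 - x) ^ (β - 1)) volume 0 1 := by
  have h := Complex.betaIntegral_convergent (u := α) (v := β) (by simpa) (by simpa)
  rw [intervalIntegrable_iff_integrableOn_Ioc_of_le zero_le_one] at h ⊢
  refine (integrableOn_congr_fun (fun x hx => ?_) measurableSet_Ioc).1 h.re
  rw [← ofReal_rpow_mul_one_sub_rpow α β (Ioc_subset_Icc_self hx), RCLike.re_eq_complex_re,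
    Complex.ofReal_re]

theorem integral_rpow_mul_one_sub_rpow {α β : ℝ} (hα : 0 < α) (hβ : 0 < β) :
    ∫ x in (0 : ℝ)..1, x ^ (α - 1) * (1 - x) ^ (β - 1) = ProbabilityTheory.beta α β := by
  rw [ProbabilityTheory.beta_eq_betaIntegralReal α β hα hβ, Complex.betaIntegral,
    ← Complex.ofReal_re (∫ x in (0 : ℝ)..1, _), ← intervalIntegral.integral_ofReal]
  congr 1
  refine intervalIntegral.integral_congr fun x hx => ?_
  exact ofReal_rpow_mul_one_sub_rpow α β (by rwa [uIcc_of_le zero_le_one] at hx)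

theorem tendsto_integral_rpow_mul_one_sub_rpow {α β : ℝ} (hα : 0 < α) (hβ : 0 < β) :
    Tendsto (fun a : ℝ => ∫ x in a..1, x ^ (α - 1) * (1 - x) ^ (β - 1)) (𝓝[>] 0)
      (𝓝 (ProbabilityTheory.beta α β)) := by
  have hprim := intervalIntegral.continuousOn_primitive_interval_left (a := 0) (b := 1)
    (μ := volume) ((intervalIntegrable_iff' (by simp)).1
      (intervalIntegrable_rpow_mul_one_sub_rpow hα hβ)) 0 (by simp)
  rw [ContinuousWithinAt, integral_rpow_mul_one_sub_rpow hα hβ, uIcc_of_le zero_le_one] at hprim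
  refine hprim.mono_left ?_
  rw [← nhdsWithin_Ioc_eq_nhdsGT (zero_lt_one (α := ℝ))]
  exact nhdsWithin_mono _ Ioc_subset_Icc_self

theorem integral_one_sub_rpow_mul_rpow (hp : 0 < p) (hq : q ≠ 0) {a : ℝ} (ha₀ : 0 < a)
    (ha₁ : a ≤ 1) :
    ∫ x in a..1, (1 - x) ^ p * x ^ (-q - 1) =
      a ^ (-q) * (1 - a) ^ p / q - p / q * ∫ x in a..1, x ^ (-q) * (1 - x) ^ (p - 1) := by
  have hpos : ∀ x ∈ uIcc a 1, x ≠ 0 := fun x hx => by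
    rw [uIcc_of_le ha₁] at hx
    exact (ha₀.trans_le hx.1).ne'
  have hIoo : Ioo (min a 1) (max a 1) ⊆ Ioo 0 1 := by
    rw [min_eq_left ha₁, max_eq_right ha₁]
    exact Ioo_subset_Ioo_left ha₀.le
  have hderiv₁ : ∀ x ∈ Ioo (min a 1) (max a 1),
      HasDerivAt (fun x : ℝ => (1 - x) ^ p) (-p * (1 - x) ^ (p - 1)) x := fun x hx =>
    (((hasDerivAt_id' x).const_sub 1).rpow_const (Or.inl (sub_pos.2 (hIoo hx).2).ne')).congr_deriv
      (by ring)
  have hderiv₂ : ∀ x ∈ Ioo (min a 1) (max a 1),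
      HasDerivAt (fun x : ℝ => -x ^ (-q) / q) (x ^ (-q - 1)) x := fun x hx =>
    (((hasDerivAt_id' x).rpow_const (p := -q) (Or.inl (hIoo hx).1.ne')).neg.div_const
      q).congr_deriv (by field_simp)
  have hint₁ : IntervalIntegrable (fun x : ℝ => -p * (1 - x) ^ (p - 1)) volume a 1 := by
    simpa using ((intervalIntegral.intervalIntegrable_rpow' (a := 1 - a) (b := 0) (r := p - 1)
      (by linarith)).comp_sub_left 1).const_mul (-p)
  have hint₂ : IntervalIntegrable (fun x : ℝ => x ^ (-q - 1)) volume a 1 :=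
    (ContinuousOn.rpow_const continuousOn_id fun x hx => .inl (hpos x hx)).intervalIntegrable
  have hcont₁ : ContinuousOn (fun x : ℝ => (1 - x) ^ p) (uIcc a 1) :=
    .rpow_const (by fun_prop) fun x _ => .inr hp.le
  have hcont₂ : ContinuousOn (fun x : ℝ => -x ^ (-q) / q) (uIcc a 1) :=
    (ContinuousOn.rpow_const (by fun_prop) fun x hx => .inl (hpos x hx)).neg.div_const q
  rw [intervalIntegral.integral_mul_deriv_eq_deriv_mul_of_hasDerivAt hcont₁ hcont₂ hderiv₁ hderiv₂
    hint₁ hint₂, sub_self, Real.zero_rpow hp.ne', ← intervalIntegral.integral_const_mul]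
  have hcongr : ∀ x : ℝ, -p * (1 - x) ^ (p - 1) * (-x ^ (-q) / q) =
      p / q * (x ^ (-q) * (1 - x) ^ (p - 1)) := fun x => by ring
  simp only [hcongr]
  ring

theorem tendsto_rpow_nhdsGT_zero (hp : 0 < p) : Tendsto (fun x : ℝ => x ^ p) (𝓝[>] 0) (𝓝 0) := by
  have h := (Real.continuousAt_rpow_const 0 p (.inr hp.le)).tendsto
  rw [Real.zero_rpow hp.ne'] at h
  exact h.mono_left nhdsWithin_le_nhds

theorem tendsto_rpow_neg_mul_one_sub_one_sub_rpow (p : ℝ) (hq : q < 1) :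
    Tendsto (fun a : ℝ => a ^ (-q) * (1 - (1 - a) ^ p)) (𝓝[>] 0) (𝓝 0) := by
  have hbigO : (fun a : ℝ => (1 - a) ^ p - (1 - 0) ^ p) =O[𝓝 0] fun a => a - 0 :=
    (DifferentiableAt.rpow_const (by fun_prop) (by simp)).isBigO_sub
  have hlin : (fun a : ℝ => 1 - (1 - a) ^ p) =O[𝓝[>] 0] fun a => a := by
    simpa using (hbigO.mono nhdsWithin_le_nhds).neg_left
  refine ((isBigO_refl (fun a : ℝ => a ^ (-q)) _).mul hlin).trans_tendsto ?_
  refine (tendsto_rpow_nhdsGT_zero (sub_pos.2 hq)).congr' ?_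
  filter_upwards [self_mem_nhdsWithin] with a ha
  rw [show 1 - q = -q + 1 by ring, Real.rpow_add_one (mem_Ioi.1 ha).ne']

theorem tendsto_rpow_neg_div_sub_integral (hp : 0 < p) (hq₀ : 0 < q) (hq₁ : q < 1) :
    Tendsto (fun a : ℝ => a ^ (-q) / q - ∫ x in a..1, (1 - x) ^ p * x ^ (-q - 1)) (𝓝[>] 0)
      (𝓝 (p / q * ProbabilityTheory.beta (1 - q) p)) := by
  have hsum := ((tendsto_rpow_neg_mul_one_sub_one_sub_rpow p hq₁).div_const q).add
    ((tendsto_integral_rpow_mul_one_sub_rpow (sub_pos.2 hq₁) hp).const_mul (p / q))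
  rw [zero_div, zero_add] at hsum
  refine hsum.congr' ?_
  filter_upwards [Ioo_mem_nhdsGT one_pos] with a ha
  rw [integral_one_sub_rpow_mul_rpow hp hq₀.ne' ha.1 ha.2.le, sub_sub_cancel_left]
  ring

end BetaIntegral

section ChordRoot

/-- The positive root `r` of `r² + 2bxr = cx`, for `c, x > 0`. Equivalently
`(c - 2br - r²) / r² = 1/x - 1`: this makes `x` the integration variable on a ray along which
`1 - |·|²` equals `c - 2br - r²`. -/
noncomputable def chordRoot (c b x : ℝ) : ℝ :=
  √(b ^ 2 * x ^ 2 + c * x) - b * x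

variable {c b x : ℝ}

theorem chordRoot_pos (hc : 0 < c) (hx : 0 < x) : 0 < chordRoot c b x := by
  refine sub_pos.2 ((le_abs_self _).trans_lt ?_)
  rw [← Real.sqrt_sq_eq_abs, mul_pow]
  exact Real.sqrt_lt_sqrt (by positivity) (lt_add_of_pos_right _ (mul_pos hc hx))

theorem chordRoot_mul_chordRoot_neg (hc : 0 ≤ c) (hx : 0 ≤ x) :
    chordRoot c b x * chordRoot c (-b) x = c * x := by
  have hsq := Real.sq_sqrt (show 0 ≤ b ^ 2 * x ^ 2 + c * x by positivity)
  rw [chordRoot, chordRoot, neg_sq]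
  linear_combination hsq

theorem chordRoot_neg_sub_chordRoot : chordRoot c (-b) x - chordRoot c b x = 2 * b * x := by
  rw [chordRoot, chordRoot, neg_sq]
  ring

theorem chordRoot_sq_add (h : 0 ≤ b ^ 2 * x ^ 2 + c * x) :
    chordRoot c b x ^ 2 + 2 * b * x * chordRoot c b x = c * x := by
  rw [chordRoot]
  linear_combination Real.sq_sqrt h

theorem chordRoot_quadratic (hc : 0 ≤ c) (hx : 0 < x) :
    c - 2 * b * chordRoot c b x - chordRoot c b x ^ 2 = chordRoot c b x ^ 2 * (1 / x - 1) := by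
  have hroot := chordRoot_sq_add (show 0 ≤ b ^ 2 * x ^ 2 + c * x by positivity)
  field_simp
  linear_combination -hroot

theorem chordRoot_eq_sqrt_mul (hx : 0 ≤ x) :
    chordRoot c b x = √x * chordRoot c (b * √x) 1 := by
  have hfactor : b ^ 2 * x ^ 2 + c * x = x * ((b * √x) ^ 2 * 1 ^ 2 + c * 1) := by
    rw [mul_pow, Real.sq_sqrt hx]
    ring
  rw [chordRoot, chordRoot, hfactor, Real.sqrt_mul hx]
  linear_combination b * Real.mul_self_sqrt hx

theorem contDiffOn_chordRoot {m : ℕ∞} (hc : 0 < c) :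
    ContDiffOn ℝ m (chordRoot c b) (Ioi 0) := fun x (hx : 0 < x) => by
  have hpos : b ^ 2 * x ^ 2 + c * x ≠ 0 := by positivity
  have hsq : ContDiffAt ℝ m (fun y => b ^ 2 * y ^ 2 + c * y) x := by fun_prop
  have hlin : ContDiffAt ℝ m (fun y => b * y) x := by fun_prop
  exact ((hsq.sqrt hpos).sub hlin).contDiffWithinAt

theorem continuousOn_deriv_chordRoot (hc : 0 < c) :
    ContinuousOn (deriv (chordRoot c b)) (Ioi 0) :=
  (contDiffOn_chordRoot (m := 1) hc).continuousOn_deriv_of_isOpen isOpen_Ioi le_rfl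

theorem differentiableAt_chordRoot (hc : 0 < c) (hx : 0 < x) :
    DifferentiableAt ℝ (chordRoot c b) x :=
  ((contDiffOn_chordRoot (m := 1) hc).differentiableOn (by simp)).differentiableAt (Ioi_mem_nhds hx)

theorem continuousOn_logDeriv_chordRoot (hc : 0 < c) :
    ContinuousOn (logDeriv (chordRoot c b)) (Ioi 0) :=
  (continuousOn_deriv_chordRoot hc).div (contDiffOn_chordRoot (m := 0) hc).continuousOn
    fun _ hx => (chordRoot_pos hc hx).ne'

theorem logDeriv_chordRoot_add_logDeriv_chordRoot_neg (hc : 0 < c) (hx : 0 < x) :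
    logDeriv (chordRoot c b) x + logDeriv (chordRoot c (-b)) x = x⁻¹ := by
  rw [← logDeriv_mul x (chordRoot_pos hc hx).ne' (chordRoot_pos hc hx).ne'
    (differentiableAt_chordRoot hc hx) (differentiableAt_chordRoot hc hx)]
  have hprod : (fun y => chordRoot c b y * chordRoot c (-b) y) =ᶠ[𝓝 x] fun y => c * y := by
    filter_upwards [Ioi_mem_nhds hx] with y hy
    exact chordRoot_mul_chordRoot_neg hc.le (mem_Ioi.1 hy).le
  rw [logDeriv_apply, hprod.deriv_eq, hprod.eq_of_nhds, deriv_const_mul_id']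
  field_simp

theorem differentiableAt_chordRoot_one_rpow (hc : 0 < c) (b p : ℝ) :
    DifferentiableAt ℝ (fun y => chordRoot c (b * y) 1 ^ p) 0 := by
  refine DifferentiableAt.rpow_const ?_ (.inl (chordRoot_pos hc one_pos).ne')
  unfold chordRoot
  exact (DifferentiableAt.sqrt (by fun_prop) (by simpa using hc.ne')).sub (by fun_prop)

theorem chordRoot_rpow (hc : 0 < c) (hx : 0 < x) (p : ℝ) :
    chordRoot c b x ^ p = x ^ (p / 2) * chordRoot c (b * √x) 1 ^ p := by
  rw [chordRoot_eq_sqrt_mul hx.le, Real.mul_rpow (Real.sqrt_nonneg x)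
    (chordRoot_pos hc one_pos).le, Real.sqrt_eq_rpow, ← Real.rpow_mul hx.le, one_div_mul_eq_div]

theorem tendsto_sqrt_nhdsGT_zero : Tendsto Real.sqrt (𝓝[>] 0) (𝓝 0) := by
  simpa using (Real.continuous_sqrt.tendsto 0).mono_left nhdsWithin_le_nhds

theorem isBigO_chordRoot_rpow (hc : 0 < c) (b p : ℝ) :
    (fun a => chordRoot c b a ^ p) =O[𝓝[>] 0] fun a => a ^ (p / 2) := by
  have hbdd := ((differentiableAt_chordRoot_one_rpow hc b p).continuousAt.tendsto.comp
    tendsto_sqrt_nhdsGT_zero).isBigO_one ℝ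
  refine ((isBigO_refl (fun a : ℝ => a ^ (p / 2)) _).mul hbdd).congr' ?_ (by simp)
  filter_upwards [self_mem_nhdsWithin] with a ha
  exact (chordRoot_rpow hc ha p).symm

theorem isBigO_chordRoot_rpow_sub (hc : 0 < c) (b p : ℝ) :
    (fun a => chordRoot c b a ^ p - chordRoot c (-b) a ^ p) =O[𝓝[>] 0]
      fun a => a ^ (p / 2) * √a := by
  have hlin : ∀ β : ℝ, (fun a => chordRoot c (β * √a) 1 ^ p - chordRoot c 0 1 ^ p) =O[𝓝[>] 0]
      Real.sqrt := fun β => by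
    simpa [Function.comp_def] using
      (differentiableAt_chordRoot_one_rpow hc β p).isBigO_sub.comp_tendsto tendsto_sqrt_nhdsGT_zero
  refine ((isBigO_refl (fun a : ℝ => a ^ (p / 2)) _).mul ((hlin b).sub (hlin (-b)))).congr' ?_ .rfl
  filter_upwards [self_mem_nhdsWithin] with a ha
  rw [chordRoot_rpow hc ha, chordRoot_rpow hc ha]
  ring

theorem tendsto_chordRoot_nhdsGT_zero (c b : ℝ) : Tendsto (chordRoot c b) (𝓝[>] 0) (𝓝 0) := by
  have hcont : Continuous (chordRoot c b) := by
    unfold chordRoot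
    fun_prop
  simpa [chordRoot] using (hcont.tendsto 0).mono_left nhdsWithin_le_nhds

theorem tendsto_chordRoot_rpow_sub_rpow {s : ℝ} (hs₁ : s < 1) (hc : 0 < c) (b : ℝ) :
    Tendsto (fun a => c ^ s * (chordRoot c b a ^ (-(2 * s)) + chordRoot c (-b) a ^ (-(2 * s))) -
      2 * a ^ (-s)) (𝓝[>] 0) (𝓝 0) := by
  have hsq := ((isBigO_chordRoot_rpow_sub hc b (-s)).pow 2).const_mul_left (c ^ s)
  have hlim : Tendsto (fun a : ℝ => (a ^ (-s / 2) * √a) ^ 2) (𝓝[>] 0) (𝓝 0) := by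
    refine (tendsto_rpow_nhdsGT_zero (sub_pos.2 hs₁)).congr' ?_
    filter_upwards [self_mem_nhdsWithin] with a ha
    have ha₀ : 0 < a := ha
    rw [mul_pow, Real.sq_sqrt ha₀.le, ← Real.rpow_mul_natCast ha₀.le, ← Real.rpow_add_one ha₀.ne']
    congr 1
    push_cast
    ring
  refine (hsq.trans_tendsto hlim).congr' ?_
  filter_upwards [self_mem_nhdsWithin] with a ha
  have hρ : 0 < chordRoot c b a ∧ 0 < chordRoot c (-b) a :=
    ⟨chordRoot_pos hc ha, chordRoot_pos hc ha⟩
  have hcross : c ^ s * (chordRoot c b a ^ (-s) * chordRoot c (-b) a ^ (-s)) = a ^ (-s) := by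
    rw [← Real.mul_rpow hρ.1.le hρ.2.le, chordRoot_mul_chordRoot_neg hc.le (mem_Ioi.1 ha).le,
      Real.mul_rpow hc.le (mem_Ioi.1 ha).le, ← mul_assoc, ← Real.rpow_add hc, add_neg_cancel,
      Real.rpow_zero, one_mul]
  have hsquare : ∀ r : ℝ, 0 < r → r ^ (-(2 * s)) = (r ^ (-s)) ^ 2 := fun r hr => by
    rw [← Real.rpow_mul_natCast hr.le]
    congr 1
    push_cast
    ring
  rw [hsquare _ hρ.1, hsquare _ hρ.2]
  linear_combination (-2) * hcross

end ChordRoot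

section ChordPower

theorem contDiffAt_max_zero_rpow {E : Type*} [NormedAddCommGroup E] [NormedSpace ℝ E] {m : ℕ∞}
    {g : E → ℝ} {x : E} (hg : ContDiffAt ℝ m g x) (hx : 0 < g x) (s : ℝ) :
    ContDiffAt ℝ m (fun y => max (g y) 0 ^ s) x := by
  refine (hg.rpow_const_of_ne (p := s) hx.ne').congr_of_eventuallyEq ?_
  filter_upwards [hg.continuousAt.eventually (lt_mem_nhds hx)] with y hy
  rw [max_eq_left hy.le]

/-- The function `(1 - |·|²)₊^s` at distance `r` along a ray, where `c` is the value of `1 - |·|²`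
at the origin of the ray and `b` the inner product of this origin with the direction. -/
noncomputable def chordPower (s c b r : ℝ) : ℝ :=
  max (c - 2 * b * r - r ^ 2) 0 ^ s

variable {s c b : ℝ}

theorem chordPower_zero (hc : 0 ≤ c) : chordPower s c b 0 = c ^ s := by
  simp [chordPower, hc]

theorem chordPower_neg (r : ℝ) : chordPower s c (-b) r = chordPower s c b (-r) := by
  simp [chordPower]

theorem abs_chordPower_le (hs : 0 ≤ s) (hc : 0 ≤ c) (r : ℝ) :
    |chordPower s c b r| ≤ (c + b ^ 2) ^ s := by
  rw [chordPower, abs_of_nonneg (by positivity)]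
  exact Real.rpow_le_rpow (le_max_right _ _)
    (max_le (by linarith [sq_nonneg (b + r)]) (by positivity)) hs

theorem continuous_chordPower (hs : 0 ≤ s) : Continuous (chordPower s c b) :=
  Continuous.rpow_const (by fun_prop) fun _ => .inr hs

theorem contDiffAt_chordPower_zero {m : ℕ∞} (hc : 0 < c) : ContDiffAt ℝ m (chordPower s c b) 0 := by
  have hpoly : ContDiffAt ℝ m (fun r : ℝ => c - 2 * b * r - r ^ 2) 0 := by fun_prop
  exact contDiffAt_max_zero_rpow hpoly (by simpa using hc) s

theorem chordPower_eq_zero (hs : s ≠ 0) {r : ℝ} (hr : chordRoot c b 1 ≤ r) :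
    chordPower s c b r = 0 := by
  have hsqrt : √(b ^ 2 + c) ≤ b + r := by
    simpa [chordRoot, add_comm] using hr
  have hsq : b ^ 2 + c ≤ (b + r) ^ 2 := (Real.sqrt_le_iff.1 hsqrt).2
  rw [chordPower, max_eq_right (by linarith), Real.zero_rpow hs]

theorem integrableOn_chordPower_mul_rpow (hs : 0 < s) (hc : 0 ≤ c) {δ : ℝ} (hδ : 0 < δ) :
    IntegrableOn (fun r => chordPower s c b r * r ^ (-1 - 2 * s)) (Ioi δ) :=
  (integrableOn_Ioi_rpow_of_lt (by linarith) hδ).bdd_mul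
    (continuous_chordPower hs.le).aestronglyMeasurable (.of_forall (abs_chordPower_le hs.le hc))

theorem chordPower_chordRoot_mul_rpow (hc : 0 < c) {x : ℝ} (hx₀ : 0 < x) (hx₁ : x ≤ 1) :
    chordPower s c b (chordRoot c b x) * chordRoot c b x ^ (-1 - 2 * s) *
      deriv (chordRoot c b) x = (1 / x - 1) ^ s * logDeriv (chordRoot c b) x := by
  have hρ : 0 < chordRoot c b x := chordRoot_pos hc hx₀
  have hlevel : 0 ≤ 1 / x - 1 := sub_nonneg.2 ((one_le_div hx₀).2 hx₁)
  have hpow : (chordRoot c b x ^ 2) ^ s * chordRoot c b x ^ (-1 - 2 * s) =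
      (chordRoot c b x)⁻¹ := by
    rw [← Real.rpow_natCast_mul hρ.le, ← Real.rpow_add hρ, ← Real.rpow_neg_one]
    congr 1
    push_cast
    ring
  rw [chordPower, chordRoot_quadratic hc.le hx₀, max_eq_left (by positivity),
    Real.mul_rpow (by positivity) hlevel, logDeriv_apply]
  linear_combination (1 / x - 1) ^ s * deriv (chordRoot c b) x * hpow

theorem integral_Ioi_chordRoot_chordPower_mul_rpow (hs : 0 < s) (hc : 0 < c) {a : ℝ} (ha₀ : 0 < a)
    (ha₁ : a ≤ 1) :
    ∫ r in Ioi (chordRoot c b a), chordPower s c b r * r ^ (-1 - 2 * s) =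
      ∫ x in a..1, (1 / x - 1) ^ s * logDeriv (chordRoot c b) x := by
  have hpos : ∀ x ∈ uIcc a 1, 0 < x := fun x hx => by
    rw [uIcc_of_le ha₁] at hx
    exact ha₀.trans_le hx.1
  have htail : ∫ r in Ioi (chordRoot c b 1), chordPower s c b r * r ^ (-1 - 2 * s) = 0 := by
    refine setIntegral_eq_zero_of_forall_eq_zero fun r hr => ?_
    rw [chordPower_eq_zero hs.ne' (mem_Ioi.1 hr).le, zero_mul]
  have hcont : ContinuousOn (fun r => chordPower s c b r * r ^ (-1 - 2 * s))
      (chordRoot c b '' uIcc a 1) := by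
    refine (continuous_chordPower hs.le).continuousOn.mul
      (continuousOn_id.rpow_const fun r hr => .inl ?_)
    obtain ⟨x, hx, rfl⟩ := hr
    exact (chordRoot_pos hc (hpos x hx)).ne'
  calc ∫ r in Ioi (chordRoot c b a), chordPower s c b r * r ^ (-1 - 2 * s)
      = ∫ r in chordRoot c b a..chordRoot c b 1, chordPower s c b r * r ^ (-1 - 2 * s) := by
        rw [← intervalIntegral.integral_interval_add_Ioi
          (integrableOn_chordPower_mul_rpow hs hc.le (chordRoot_pos hc ha₀))
          (integrableOn_chordPower_mul_rpow hs hc.le (chordRoot_pos hc one_pos)), htail, add_zero]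
    _ = ∫ x in a..1, chordPower s c b (chordRoot c b x) * chordRoot c b x ^ (-1 - 2 * s) *
          deriv (chordRoot c b) x :=
        (intervalIntegral.integral_comp_mul_deriv'
          (fun x hx => (differentiableAt_chordRoot hc (hpos x hx)).hasDerivAt)
          ((continuousOn_deriv_chordRoot hc).mono hpos) hcont).symm
    _ = ∫ x in a..1, (1 / x - 1) ^ s * logDeriv (chordRoot c b) x :=
        intervalIntegral.integral_congr fun x hx =>
          chordPower_chordRoot_mul_rpow hc (hpos x hx) (by rw [uIcc_of_le ha₁] at hx; exact hx.2)

theorem integral_Ioi_chordPower_add_integral_Ioi_chordPower_neg (hs : 0 < s) (hc : 0 < c) (b : ℝ)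
    {a : ℝ} (ha₀ : 0 < a) (ha₁ : a ≤ 1) :
    (∫ r in Ioi (chordRoot c b a), chordPower s c b r * r ^ (-1 - 2 * s)) +
        ∫ r in Ioi (chordRoot c (-b) a), chordPower s c (-b) r * r ^ (-1 - 2 * s) =
      ∫ x in a..1, (1 - x) ^ s * x ^ (-s - 1) := by
  have hmem : ∀ x ∈ uIcc a 1, 0 < x ∧ x ≤ 1 := fun x hx => by
    rw [uIcc_of_le ha₁] at hx
    exact ⟨ha₀.trans_le hx.1, hx.2⟩
  have hint : ∀ β, IntervalIntegrable (fun x => (1 / x - 1) ^ s * logDeriv (chordRoot c β) x)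
      volume a 1 := fun β => by
    refine ContinuousOn.intervalIntegrable (.mul ?_
      ((continuousOn_logDeriv_chordRoot hc).mono fun x hx => (hmem x hx).1))
    exact ((continuousOn_const.div continuousOn_id fun x hx => (hmem x hx).1.ne').sub
      continuousOn_const).rpow_const fun _ _ => .inr hs.le
  rw [integral_Ioi_chordRoot_chordPower_mul_rpow hs hc ha₀ ha₁,
    integral_Ioi_chordRoot_chordPower_mul_rpow hs hc ha₀ ha₁,
    ← intervalIntegral.integral_add (hint b) (hint (-b))]
  refine intervalIntegral.integral_congr fun x hx => ?_
  obtain ⟨hx₀, hx₁⟩ := hmem x hx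
  have hlevel : 1 / x - 1 = (1 - x) / x := by field_simp
  rw [← mul_add, logDeriv_chordRoot_add_logDeriv_chordRoot_neg hc hx₀, hlevel,
    Real.div_rpow (sub_nonneg.2 hx₁) hx₀.le, Real.rpow_sub_one hx₀.ne', Real.rpow_neg hx₀.le]
  ring

theorem integrableOn_sub_chordPower_mul_rpow (hs : 0 < s) (hc : 0 ≤ c) {δ : ℝ} (hδ : 0 < δ) :
    IntegrableOn (fun r => (c ^ s - chordPower s c b r) * r ^ (-1 - 2 * s)) (Ioi δ) := by
  simp only [sub_mul]
  exact ((integrableOn_Ioi_rpow_of_lt (by linarith) hδ).const_mul _).sub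
    (integrableOn_chordPower_mul_rpow hs hc hδ)

theorem integral_Ioi_sub_chordPower_mul_rpow (hs : 0 < s) (hc : 0 ≤ c) {δ : ℝ} (hδ : 0 < δ) :
    ∫ r in Ioi δ, (c ^ s - chordPower s c b r) * r ^ (-1 - 2 * s) =
      c ^ s * (δ ^ (-(2 * s)) / (2 * s)) -
        ∫ r in Ioi δ, chordPower s c b r * r ^ (-1 - 2 * s) := by
  simp only [sub_mul]
  rw [integral_sub ((integrableOn_Ioi_rpow_of_lt (by linarith) hδ).const_mul _)
    (integrableOn_chordPower_mul_rpow hs hc hδ), integral_const_mul,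
    integral_Ioi_rpow_of_lt (by linarith) hδ, show -1 - 2 * s + 1 = -(2 * s) by ring,
    neg_div_neg_eq]

theorem tendsto_integral_Ioi_chordRoot_add (hs₀ : 0 < s) (hs₁ : s < 1) (hc : 0 < c) (b : ℝ) :
    Tendsto (fun a =>
        (∫ r in Ioi (chordRoot c b a), (c ^ s - chordPower s c b r) * r ^ (-1 - 2 * s)) +
          ∫ r in Ioi (chordRoot c (-b) a), (c ^ s - chordPower s c (-b) r) * r ^ (-1 - 2 * s))
      (𝓝[>] 0) (𝓝 (ProbabilityTheory.beta s (1 - s))) := by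
  have hlim := ((tendsto_chordRoot_rpow_sub_rpow hs₁ hc b).div_const (2 * s)).add
    (tendsto_rpow_neg_div_sub_integral hs₀ hs₀ hs₁)
  rw [zero_div, zero_add, div_self hs₀.ne', one_mul, ProbabilityTheory.beta,
    mul_comm (Real.Gamma _), add_comm (1 - s), ← ProbabilityTheory.beta] at hlim
  refine hlim.congr' ?_
  filter_upwards [Ioo_mem_nhdsGT one_pos] with a ha
  rw [integral_Ioi_sub_chordPower_mul_rpow hs₀ hc.le (chordRoot_pos hc ha.1),
    integral_Ioi_sub_chordPower_mul_rpow hs₀ hc.le (chordRoot_pos hc ha.1),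
    ← integral_Ioi_chordPower_add_integral_Ioi_chordPower_neg hs₀ hc b ha.1 ha.2.le]
  field_simp
  ring

theorem rpow_le_rpow_add_rpow_of_mem_uIoc {p x y r : ℝ} (hp : p ≤ 0) (hx : 0 < x) (hy : 0 < y)
    (hr : r ∈ uIoc x y) : r ^ p ≤ x ^ p + y ^ p := by
  rcases mem_uIoc.1 hr with h | h
  · exact (Real.rpow_le_rpow_of_nonpos hx h.1.le hp).trans
      (le_add_of_nonneg_right (Real.rpow_nonneg hy.le p))
  · exact (Real.rpow_le_rpow_of_nonpos hy h.1.le hp).trans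
      (le_add_of_nonneg_left (Real.rpow_nonneg hx.le p))

theorem isBigO_sub_chordPower_mul_rpow (hs : s ≠ 0) (hc : 0 < c) (b : ℝ) :
    (fun r => (c ^ s - chordPower s c b r) * r ^ (-1 - 2 * s)) =O[𝓝[>] 0]
      fun r => r ^ (-(2 * s)) := by
  have hlin : (fun r => c ^ s - chordPower s c b r) =O[𝓝 0] fun r => r := by
    simpa [chordPower_zero hc.le] using ((contDiffAt_chordPower_zero (s := s) (b := b)
      (m := 1) hc).differentiableAt (by simp)).isBigO_sub.neg_left
  refine ((hlin.mono nhdsWithin_le_nhds).mul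
    (isBigO_refl (fun r => r ^ (-1 - 2 * s)) _)).trans_eventuallyEq ?_
  filter_upwards [self_mem_nhdsWithin] with r hr
  rw [← Real.rpow_one_add' (mem_Ioi.1 hr).le (by simpa [← add_sub_assoc] using hs)]
  ring_nf

theorem tendsto_integral_chordRoot_chordRoot_neg (hs₀ : 0 < s) (hs₁ : s < 1) (hc : 0 < c) (b : ℝ) :
    Tendsto (fun a => ∫ r in chordRoot c b a..chordRoot c (-b) a,
      (c ^ s - chordPower s c (-b) r) * r ^ (-1 - 2 * s)) (𝓝[>] 0) (𝓝 0) := by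
  obtain ⟨C, hC₀, hC⟩ := (isBigO_sub_chordPower_mul_rpow hs₀.ne' hc (-b)).exists_pos
  obtain ⟨ρ, hρ, hnear⟩ := mem_nhdsGT_iff_exists_Ioo_subset.1 hC.bound
  have hbound : (fun a => C * (chordRoot c b a ^ (-(2 * s)) + chordRoot c (-b) a ^ (-(2 * s))) *
      |2 * b * a|) =O[𝓝[>] 0] fun a => a ^ (-(2 * s) / 2) * a :=
    (((isBigO_chordRoot_rpow hc b _).add (isBigO_chordRoot_rpow hc (-b) _)).const_mul_left C).mul
      ((isBigO_refl _ _).const_mul_left (2 * b)).abs_left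
  have hlim : Tendsto (fun a : ℝ => a ^ (-(2 * s) / 2) * a) (𝓝[>] 0) (𝓝 0) := by
    refine (tendsto_rpow_nhdsGT_zero (sub_pos.2 hs₁)).congr' ?_
    filter_upwards [self_mem_nhdsWithin] with a ha
    rw [← Real.rpow_add_one (ne_of_gt ha)]
    congr 1
    ring
  refine squeeze_zero_norm' ?_ (hbound.trans_tendsto hlim)
  filter_upwards [self_mem_nhdsWithin,
    (tendsto_chordRoot_nhdsGT_zero c b).eventually (gt_mem_nhds hρ),
    (tendsto_chordRoot_nhdsGT_zero c (-b)).eventually (gt_mem_nhds hρ)] with a ha hlt₁ hlt₂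
  have hρ₁ : 0 < chordRoot c b a := chordRoot_pos hc ha
  have hρ₂ : 0 < chordRoot c (-b) a := chordRoot_pos hc ha
  rw [← chordRoot_neg_sub_chordRoot (c := c)]
  refine intervalIntegral.norm_integral_le_of_norm_le_const fun r hr => ?_
  have hr₀ : 0 < r := (lt_min hρ₁ hρ₂).trans hr.1
  calc ‖(c ^ s - chordPower s c (-b) r) * r ^ (-1 - 2 * s)‖
      ≤ C * ‖r ^ (-(2 * s))‖ := hnear ⟨hr₀, hr.2.trans_lt (max_lt hlt₁ hlt₂)⟩
    _ = C * r ^ (-(2 * s)) := by rw [Real.norm_of_nonneg (Real.rpow_nonneg hr₀.le _)]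
    _ ≤ C * (chordRoot c b a ^ (-(2 * s)) + chordRoot c (-b) a ^ (-(2 * s))) := by
        gcongr
        exact rpow_le_rpow_add_rpow_of_mem_uIoc (by linarith) hρ₁ hρ₂ hr

theorem integrableOn_secondDiff_chordPower (hs₀ : 0 < s) (hs₁ : s < 1) (hc : 0 < c) :
    IntegrableOn (fun r => (2 * c ^ s - chordPower s c b r - chordPower s c (-b) r) *
      r ^ (-1 - 2 * s)) (Ioi 0) := by
  have hcont : Continuous fun r => 2 * c ^ s - chordPower s c b r - chordPower s c (-b) r :=
    (continuous_const.sub (continuous_chordPower hs₀.le)).sub (continuous_chordPower hs₀.le)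
  have hquad : (fun r => 2 * c ^ s - chordPower s c b r - chordPower s c (-b) r) =O[𝓝 0]
      fun r => ‖r‖ ^ 2 := by
    simpa [chordPower_zero hc.le, chordPower_neg] using
      isBigO_second_difference (contDiffAt_chordPower_zero (s := s) (b := b) (m := 2) hc)
  have hbound : ∀ r, |2 * c ^ s - chordPower s c b r - chordPower s c (-b) r| ≤
      |2 * c ^ s| + (c + b ^ 2) ^ s + (c + (-b) ^ 2) ^ s := fun r =>
    (abs_sub _ _).trans (add_le_add ((abs_sub _ _).trans
      (add_le_add_right (abs_chordPower_le hs₀.le hc.le r) _)) (abs_chordPower_le hs₀.le hc.le r))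
  have hint := integrable_div_norm_rpow (μ := volume) hs₀ hs₁ hcont.aestronglyMeasurable hquad
    hbound
  refine (integrableOn_congr_fun (fun r hr => ?_) measurableSet_Ioi).1 hint.integrableOn
  have hr₀ : 0 < r := hr
  rw [Module.finrank_self, Nat.cast_one, Real.norm_of_nonneg hr₀.le, div_eq_mul_inv,
    ← Real.rpow_neg hr₀.le, neg_add']

theorem integral_Ioi_secondDiff_chordPower (hs₀ : 0 < s) (hs₁ : s < 1) (hc : 0 < c) (b : ℝ) :
    ∫ r in Ioi (0 : ℝ), (2 * c ^ s - chordPower s c b r - chordPower s c (-b) r) *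
      r ^ (-1 - 2 * s) = ProbabilityTheory.beta s (1 - s) := by
  have hcover := (aecover_Ioi_of_Ioi (μ := volume)
    (tendsto_chordRoot_nhdsGT_zero c b)).integral_tendsto_of_countably_generated
      (integrableOn_secondDiff_chordPower (b := b) hs₀ hs₁ hc)
  have hlim := (tendsto_integral_Ioi_chordRoot_add hs₀ hs₁ hc b).add
    (tendsto_integral_chordRoot_chordRoot_neg hs₀ hs₁ hc b)
  rw [add_zero] at hlim
  refine tendsto_nhds_unique hcover (hlim.congr' ?_)
  filter_upwards [self_mem_nhdsWithin] with a ha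
  have hρ₁ : 0 < chordRoot c b a := chordRoot_pos hc ha
  have hρ₂ : 0 < chordRoot c (-b) a := chordRoot_pos hc ha
  rw [Measure.restrict_restrict measurableSet_Ioi,
    inter_eq_left.2 (Ioi_subset_Ioi hρ₁.le)]
  have hsplit := intervalIntegral.integral_interval_add_Ioi
    (integrableOn_sub_chordPower_mul_rpow (b := -b) hs₀ hc.le hρ₁)
    (integrableOn_sub_chordPower_mul_rpow (b := -b) hs₀ hc.le hρ₂)
  rw [add_assoc, add_comm (∫ r in Ioi (chordRoot c (-b) a), _), hsplit,
    ← integral_add (integrableOn_sub_chordPower_mul_rpow hs₀ hc.le hρ₁)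
      (integrableOn_sub_chordPower_mul_rpow hs₀ hc.le hρ₁)]
  refine integral_congr_ae (.of_forall fun r => ?_)
  ring

end ChordPower

section BallPower

variable {n : ℕ} {s : ℝ} {x : EuclideanSpace ℝ (Fin n)}

theorem continuous_ballPower (n : ℕ) (hs : 0 ≤ s) : Continuous (ballPower n s) :=
  Continuous.rpow_const (by fun_prop) fun _ => .inr hs

theorem abs_ballPower_le_one (hs : 0 ≤ s) (x : EuclideanSpace ℝ (Fin n)) :
    |ballPower n s x| ≤ 1 := by
  rw [ballPower, abs_of_nonneg (by positivity)]
  exact Real.rpow_le_one (le_max_right _ _)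
    (max_le (sub_le_self _ (sq_nonneg _)) zero_le_one) hs

theorem contDiffAt_ballPower {m : ℕ∞} (hx : ‖x‖ < 1) : ContDiffAt ℝ m (ballPower n s) x :=
  contDiffAt_max_zero_rpow (contDiffAt_const.sub (contDiff_norm_sq ℝ).contDiffAt)
    (sub_pos.2 ((sq_lt_one_iff₀ (norm_nonneg x)).2 hx)) s

theorem integrable_secondDiffQuot_ballPower [NeZero n] (hs₀ : 0 < s) (hs₁ : s < 1)
    (hx : ‖x‖ < 1) : Integrable (secondDiffQuot s (ballPower n s) x) :=
  integrable_secondDiffQuot hs₀ hs₁ (continuous_ballPower n hs₀.le).aestronglyMeasurable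
    (abs_ballPower_le_one hs₀.le) (contDiffAt_ballPower hx)

theorem ballPower_eq_rpow (hx : ‖x‖ ≤ 1) : ballPower n s x = (1 - ‖x‖ ^ 2) ^ s := by
  rw [ballPower, max_eq_left (sub_nonneg.2 (pow_le_one₀ (norm_nonneg x) hx))]

theorem ballPower_add_smul {θ : EuclideanSpace ℝ (Fin n)} (hθ : ‖θ‖ = 1) (r : ℝ) :
    ballPower n s (x + r • θ) = chordPower s (1 - ‖x‖ ^ 2) (inner ℝ x θ) r := by
  rw [ballPower, chordPower, norm_add_sq_real, real_inner_smul_right, norm_smul, hθ, mul_one,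
    Real.norm_eq_abs, sq_abs]
  congr 2
  ring

theorem integral_secondDiffQuot_ballPower [NeZero n] (hs₀ : 0 < s) (hs₁ : s < 1) (hx : ‖x‖ < 1) :
    ∫ y, secondDiffQuot s (ballPower n s) x y =
      sphereArea n * ProbabilityTheory.beta s (1 - s) := by
  have hc : 0 < 1 - ‖x‖ ^ 2 := sub_pos.2 ((sq_lt_one_iff₀ (norm_nonneg x)).2 hx)
  have hray : ∀ θ : sphere (0 : EuclideanSpace ℝ (Fin n)) 1, ∫ r in Ioi (0 : ℝ),
      (2 * ballPower n s x - ballPower n s (x + r • (θ : EuclideanSpace ℝ (Fin n))) -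
        ballPower n s (x - r • (θ : EuclideanSpace ℝ (Fin n)))) * r ^ (-1 - 2 * s) =
      ProbabilityTheory.beta s (1 - s) := fun θ => by
    have hθ : ‖(θ : EuclideanSpace ℝ (Fin n))‖ = 1 := norm_eq_of_mem_sphere θ
    simp only [sub_eq_add_neg x, ← smul_neg, ballPower_add_smul hθ,
      ballPower_add_smul ((norm_neg _).trans hθ), inner_neg_right, ballPower_eq_rpow hx.le]
    exact integral_Ioi_secondDiff_chordPower hs₀ hs₁ hc _
  rw [integral_secondDiffQuot (integrable_secondDiffQuot_ballPower hs₀ hs₁ hx)]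
  simp only [hray, integral_const, smul_eq_mul, sphereArea]

end BallPower

end FracLap

theorem mainTheorem8 (n : ℕ) [NeZero n] (s : ℝ) (hs₀ : 0 < s) (hs₁ : s < 1) :
    0 < FracLap.fracConst n s ∧
    ∀ x ∈ Metric.ball (0 : EuclideanSpace ℝ (Fin n)) 1,
      Integrable (FracLap.secondDiffQuot s (FracLap.ballPower n s) x) ∧
      FracLap.fracLaplacian s (FracLap.ballPower n s) x =
        FracLap.fracConst n s * (FracLap.sphereArea n / 2) * ProbabilityTheory.beta s (1 - s) ∧
      FracLap.HasPVIntegral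
        (fun y => (FracLap.ballPower n s x - FracLap.ballPower n s y) /
          ‖x - y‖ ^ ((n : ℝ) + 2 * s)) x
        (FracLap.sphereArea n / 2 * ProbabilityTheory.beta s (1 - s)) := by
  refine ⟨FracLap.fracConst_pos hs₀ hs₁, fun x hx => ?_⟩
  have hx₁ : ‖x‖ < 1 := mem_ball_zero_iff.1 hx
  have hint := FracLap.integrable_secondDiffQuot_ballPower hs₀ hs₁ hx₁
  have hvalue := FracLap.integral_secondDiffQuot_ballPower hs₀ hs₁ hx₁
  have hpv := FracLap.hasPVIntegral_sub_div_norm_rpow hs₀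
    (FracLap.continuous_ballPower n hs₀.le).aestronglyMeasurable
    (FracLap.abs_ballPower_le_one hs₀.le) hint
  refine ⟨hint, ?_, ?_⟩
  · rw [FracLap.fracLaplacian, hvalue]
    ring
  · rwa [hvalue, mul_div_right_comm] at hpv
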